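/- Let $(p_{i,j})_{-1\le i,j\le 1}$ be a probability distribution on $\{-1,0,1\}^2$ (the jump law of a random walk), and let $$K(x,y)=xy\Big[\sum_{-1\le i,j\le 1}p_{i,j}x^iy^j-1\Big]\in\mathbb{C}[x,y]$$ be its kernel. Assume that the walk is non-singular, i.e. that $K$ is irreducible over $\mathbb{C}$ and is not of degree $1$ in $x$ or in $y$. Let $\mathbb{C}_Q(x,y)$ be the field of fractions of $\mathbb{C}[x,y]/(K)$, and let $W=\langle\xi,\eta\rangle$ be the group of automorphisms of $\mathbb{C}_Q(x,y)$ over $\mathbb{C}$ generated by $$\xi(x,y)=\Big(x,\frac1y\,\frac{\sum_{-1\le i\le 1}p_{i,-1}x^i}{\sum_{-1\le i\le 1}p_{i,1}x^i}\Big),\qquad \eta(x,y)=\Big(\frac1x\,\frac{\sum_{-1\le j\le 1}p_{-1,j}y^j}{\sum_{-1\le j\le 1}p_{1,j}y^j},y\Big).$$ Let the drift be $\big(\sum_{i,j} i\,p_{i,j},\ \sum_{i,j} j\,p_{i,j}\big)$ and put $$R=\frac{\sum_{i,j} ij\,p_{i,j}}{\big[\sum_{i,j} i^2p_{i,j}\big]^{1/2}\big[\sum_{i,j}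 j^2p_{i,j}\big]^{1/2}},\qquad \theta=\arccos(-R).$$ (I) If the drift is zero, then $W$ is finite if and only if $\theta/\pi$ is rational, in which case the order of $W$ is $2\inf\{\ell\in\{1,2,\ldots\}:\ell\,\theta/\pi\in\mathbb{Z}\}$. (II) If the drift is nonzero and one of the following four conditions holds, then $W$ is infinite: $p_{0,1}=p_{-1,0}=p_{-1,1}=0$; $\ p_{1,0}=p_{1,-1}=p_{0,-1}=0$; $\ p_{1,0}=p_{0,1}=p_{1,1}=0$; $\ p_{0,-1}=p_{-1,0}=p_{-1,-1}=0$. -/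

import Mathlib

open Polynomial

namespace QuarterPlane

noncomputable section

/-- The law of the jumps of a random walk whose jumps lie in `{-1, 0, 1}²`: the number `p i j`
(for `-1 ≤ i, j ≤ 1`) is the probability of the jump `(i, j)`.
Values of `p` at other indices are never used. -/
structure JumpLaw where
  p : ℤ → ℤ → ℝ
  nonneg : ∀ i ∈ Finset.Icc (-1 : ℤ) 1, ∀ j ∈ Finset.Icc (-1 : ℤ) 1, 0 ≤ p i j
  sum_eq_one : ∑ i ∈ Finset.Icc (-1 : ℤ) 1, ∑ j ∈ Finset.Icc (-1 : ℤ) 1, p i j = 1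

namespace JumpLaw

/-- The mean jump vector. -/
def drift (w : JumpLaw) : ℝ × ℝ :=
  (∑ i ∈ Finset.Icc (-1 : ℤ) 1, ∑ j ∈ Finset.Icc (-1 : ℤ) 1, (i : ℝ) * w.p i j,
    ∑ i ∈ Finset.Icc (-1 : ℤ) 1, ∑ j ∈ Finset.Icc (-1 : ℤ) 1, (j : ℝ) * w.p i j)

/-- The correlation coefficient `R` of the jumps. -/
def corr (w : JumpLaw) : ℝ :=
  (∑ i ∈ Finset.Icc (-1 : ℤ) 1, ∑ j ∈ Finset.Icc (-1 : ℤ) 1, (i : ℝ) * (j : ℝ) * w.p i j) /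
    (Real.sqrt (∑ i ∈ Finset.Icc (-1 : ℤ) 1, ∑ j ∈ Finset.Icc (-1 : ℤ) 1, (i : ℝ) ^ 2 * w.p i j) *
      Real.sqrt (∑ i ∈ Finset.Icc (-1 : ℤ) 1, ∑ j ∈ Finset.Icc (-1 : ℤ) 1, (j : ℝ) ^ 2 * w.p i j))

/-- The angle `θ = arccos (-R)`. -/
def theta (w : JumpLaw) : ℝ := Real.arccos (-w.corr)

/-- The kernel `K(x, y) = x y (∑ p i j x ^ i y ^ j - 1)`, as a polynomial in two variables:
the first variable is `C X` and the second one is `X`. -/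
def kernel (w : JumpLaw) : ℂ[X][X] :=
  ∑ i ∈ Finset.Icc (-1 : ℤ) 1, ∑ j ∈ Finset.Icc (-1 : ℤ) 1,
    C (C (w.p i j : ℂ)) * C X ^ (i + 1).toNat * X ^ (j + 1).toNat - C X * X

/-- The walk is singular if the kernel is reducible, or of degree `1` in at least one of the
variables `x` and `y`. -/
def Singular (w : JumpLaw) : Prop :=
  ¬ Irreducible w.kernel ∨ (Bivariate.swap w.kernel).natDegree = 1 ∨ w.kernel.natDegree = 1

/-- The walk is non-singular. -/
def NonSingular (w : JumpLaw) : Prop := ¬ w.Singular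

/-- The coordinate ring `ℂ[x, y] / (K)` of the curve `K = 0`. -/
abbrev CoordRing (w : JumpLaw) : Type := AdjoinRoot w.kernel

theorem NonSingular.irreducible {w : JumpLaw} (hw : w.NonSingular) : Irreducible w.kernel := by
  by_contra h
  exact hw (Or.inl h)

instance instIsDomain {w : JumpLaw} [hw : Fact w.NonSingular] : IsDomain w.CoordRing :=
  AdjoinRoot.isDomain_of_prime hw.out.irreducible.prime

/-- The field of rational functions on the curve `K = 0`: the field of fractions of its
coordinate ring. -/
def FunField (w : JumpLaw) [Fact w.NonSingular] : Type := FractionRing w.CoordRing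

instance instField (w : JumpLaw) [Fact w.NonSingular] : Field w.FunField :=
  inferInstanceAs (Field (FractionRing w.CoordRing))

instance instAlgebra (w : JumpLaw) [Fact w.NonSingular] : Algebra ℂ w.FunField :=
  inferInstanceAs (Algebra ℂ (FractionRing w.CoordRing))

instance instAlgebraCoordRing (w : JumpLaw) [Fact w.NonSingular] :
    Algebra w.CoordRing w.FunField :=
  inferInstanceAs (Algebra w.CoordRing (FractionRing w.CoordRing))

instance instIsScalarTower (w : JumpLaw) [Fact w.NonSingular] :
    IsScalarTower ℂ w.CoordRing w.FunField :=
  inferInstanceAs (IsScalarTower ℂ w.CoordRing (FractionRing w.CoordRing))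

instance instIsFractionRing (w : JumpLaw) [Fact w.NonSingular] :
    IsFractionRing w.CoordRing w.FunField :=
  inferInstanceAs (IsFractionRing w.CoordRing (FractionRing w.CoordRing))

/-- The coordinate function `x` on the curve. -/
def x (w : JumpLaw) [Fact w.NonSingular] : w.FunField :=
  algebraMap w.CoordRing w.FunField (AdjoinRoot.mk w.kernel (C X))

/-- The coordinate function `y` on the curve. -/
def y (w : JumpLaw) [Fact w.NonSingular] : w.FunField :=
  algebraMap w.CoordRing w.FunField (AdjoinRoot.mk w.kernel X)

/-- The second root `y' = (1 / y) (∑ p i (-1) x ^ i) / (∑ p i 1 x ^ i)` of the kernel, where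
`x` and `y` are elements of a field that contains `ℂ`. -/
def conjY (w : JumpLaw) {F : Type*} [Field F] [Algebra ℂ F] (x y : F) : F :=
  1 / y * ((∑ i ∈ Finset.Icc (-1 : ℤ) 1, algebraMap ℂ F (w.p i (-1)) * x ^ i) /
    (∑ i ∈ Finset.Icc (-1 : ℤ) 1, algebraMap ℂ F (w.p i 1) * x ^ i))

/-- The second root `x' = (1 / x) (∑ p (-1) j y ^ j) / (∑ p 1 j y ^ j)` of the kernel, where
`x` and `y` are elements of a field that contains `ℂ`. -/
def conjX (w : JumpLaw) {F : Type*} [Field F] [Algebra ℂ F] (x y : F) : F :=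
  1 / x * ((∑ j ∈ Finset.Icc (-1 : ℤ) 1, algebraMap ℂ F (w.p (-1) j) * y ^ j) /
    (∑ j ∈ Finset.Icc (-1 : ℤ) 1, algebraMap ℂ F (w.p 1 j) * y ^ j))

theorem icc_eq : Finset.Icc (-1 : ℤ) 1 = {-1, 0, 1} := by decide

theorem kernel_eq (w : JumpLaw) : w.kernel =
    C (C (w.p 1 1 : ℂ) * X ^ 2 + C (w.p 0 1 : ℂ) * X + C (w.p (-1) 1 : ℂ)) * X ^ 2
    + C (C (w.p 1 0 : ℂ) * X ^ 2 + C ((w.p 0 0 : ℂ) - 1) * X + C (w.p (-1) 0 : ℂ)) * X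
    + C (C (w.p 1 (-1) : ℂ) * X ^ 2 + C (w.p 0 (-1) : ℂ) * X + C (w.p (-1) (-1) : ℂ)) := by
  simp only [kernel, icc_eq]
  simp 
  ring

/-- Reflection of the jumps in the diagonal. -/
def transpose (w : JumpLaw) : JumpLaw where
  p i j := w.p j i
  nonneg i hi j hj := w.nonneg j hj i hi
  sum_eq_one := by rw [Finset.sum_comm]; exact w.sum_eq_one

theorem kernel_transpose (w : JumpLaw) : w.transpose.kernel = Bivariate.swap w.kernel := by
  rw [kernel_eq, kernel_eq]
  simp only [transpose, map_add, map_mul, map_pow, map_sub, map_one, Bivariate.swap_X,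
    Bivariate.swap_Y, Bivariate.swap_C_C]
  ring

theorem NonSingular.transpose {w : JumpLaw} (hw : w.NonSingular) : w.transpose.NonSingular := by
  have h1 : Irreducible (Bivariate.swap w.kernel) :=
    (MulEquiv.irreducible_iff (Bivariate.swap (R := ℂ)).toMulEquiv).2 hw.irreducible
  unfold NonSingular Singular at *
  rw [kernel_transpose, Bivariate.swap_swap_apply]
  tauto

theorem NonSingular.p00_ne_one {w : JumpLaw} (hw : w.NonSingular) : w.p 0 0 ≠ 1 := by
  intro h
  have hs := w.sum_eq_one
  have hn := w.nonneg
  simp [icc_eq] at hs hn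
  obtain ⟨⟨a1, a2, a3⟩, ⟨a4, a5, a6⟩, ⟨a7, a8, a9⟩⟩ := hn
  refine hw.irreducible.ne_zero ?_
  have e1 : w.p 1 1 = 0 := by linarith
  have e2 : w.p 1 0 = 0 := by linarith
  have e3 : w.p 1 (-1) = 0 := by linarith
  have e4 : w.p 0 1 = 0 := by linarith
  have e5 : w.p 0 (-1) = 0 := by linarith
  have e6 : w.p (-1) 1 = 0 := by linarith
  have e7 : w.p (-1) 0 = 0 := by linarith
  have e8 : w.p (-1) (-1) = 0 := by linarith
  simp [kernel_eq, e1, e2, e3, e4, e5, e6, e7, e8, h]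

theorem NonSingular.natDegree_ne_zero {w : JumpLaw} (hw : w.NonSingular) :
    w.kernel.natDegree ≠ 0 := by
  intro h
  have h1 : (w.kernel.coeff 1).coeff 1 = (w.p 0 0 : ℂ) - 1 := by
    rw [kernel_eq]
    simp only [coeff_add, coeff_C_mul, coeff_mul_X, coeff_X_pow, coeff_C]
    simp
  rw [coeff_eq_zero_of_natDegree_lt (p := w.kernel) (n := 1) (by omega), coeff_zero] at h1
  exact hw.p00_ne_one (by exact_mod_cast (sub_eq_zero.1 h1.symm))

theorem NonSingular.lead_ne_zero {w : JumpLaw} (hw : w.NonSingular) :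
    C (w.p 1 1 : ℂ) * X ^ 2 + C (w.p 0 1 : ℂ) * X + C (w.p (-1) 1 : ℂ) ≠ 0 := by
  intro h
  have h0 := hw.natDegree_ne_zero
  have h1 : w.kernel.natDegree ≤ 1 := by
    rw [kernel_eq, h]
    simp only [map_zero, zero_mul, zero_add]
    exact natDegree_linear_le
  exact hw (Or.inr (Or.inr (by omega)))

theorem NonSingular.const_ne_zero {w : JumpLaw} (hw : w.NonSingular) :
    C (w.p 1 (-1) : ℂ) * X ^ 2 + C (w.p 0 (-1) : ℂ) * X + C (w.p (-1) (-1) : ℂ) ≠ 0 := by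
  intro h
  have hi := hw.irreducible
  have h2 := kernel_eq w
  rw [h, map_zero, add_zero] at h2
  generalize C (w.p 1 1 : ℂ) * X ^ 2 + C (w.p 0 1 : ℂ) * X + C (w.p (-1) 1 : ℂ) = a at h2
  generalize C (w.p 1 0 : ℂ) * X ^ 2 + C ((w.p 0 0 : ℂ) - 1) * X + C (w.p (-1) 0 : ℂ) = b at h2
  have h3 : w.kernel = X * (C a * X + C b) := by rw [h2]; ring
  rcases hi.isUnit_or_isUnit h3 with h4 | h4
  · exact not_isUnit_X h4
  · refine hw (Or.inr (Or.inr ?_))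
    rw [h3, natDegree_mul X_ne_zero h4.ne_zero, natDegree_eq_zero_of_isUnit h4, natDegree_X]

section Galois

variable {F : Type*} [Field F] [Algebra ℂ F]

theorem aevalAeval_eq_eval₂ (u v : F) (g : ℂ[X][X]) :
    aevalAeval u v g = eval₂ ((aeval (R := ℂ) u : ℂ[X] →ₐ[ℂ] F) : ℂ[X] →+* F) v g := by
  induction g using Polynomial.induction_on' with
  | add p q hp hq => rw [eval₂_add, ← hp, ← hq, map_add]
  | monomial n a => rw [← C_mul_X_pow_eq_monomial]; simp

/-- A point of an irreducible curve with transcendental first coordinate is generic. -/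
theorem ker_eq_of_transcendental {K : ℂ[X][X]} (hK : Irreducible K) (hd : K.natDegree ≠ 0)
    {u v : F} (hu : Function.Injective (aeval (R := ℂ) u)) (h0 : aevalAeval u v K = 0)
    (f : ℂ[X][X]) : aevalAeval u v f = 0 ↔ K ∣ f := by
  refine ⟨fun hf => ?_, fun ⟨g, hg⟩ => by rw [hg, map_mul, h0, zero_mul]⟩
  by_contra hdvd
  have hp : K.IsPrimitive := hK.isPrimitive hd
  have hirr : Irreducible (K.map (algebraMap ℂ[X] (RatFunc ℂ))) :=
    (hp.irreducible_iff_irreducible_map_fraction_map (K := RatFunc ℂ)).1 hK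
  have hL : ¬ K.map (algebraMap ℂ[X] (RatFunc ℂ)) ∣ f.map (algebraMap ℂ[X] (RatFunc ℂ)) := fun h =>
    hdvd (hp.dvd_of_fraction_map_dvd_fraction_map h)
  obtain ⟨r, s, hrs⟩ := (hirr.coprime_iff_not_dvd).2 hL
  let ψ : RatFunc ℂ →+* F := IsFractionRing.lift (g := ((aeval (R := ℂ) u : ℂ[X] →ₐ[ℂ] F) : ℂ[X] →+* F)) hu
  have key : ∀ g : ℂ[X][X], eval₂ ψ v (g.map (algebraMap ℂ[X] (RatFunc ℂ))) = aevalAeval u v g := by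
    intro g
    rw [eval₂_map]
    have e : ψ.comp (algebraMap ℂ[X] (RatFunc ℂ)) = ((aeval (R := ℂ) u : ℂ[X] →ₐ[ℂ] F) : ℂ[X] →+* F) := by
      refine RingHom.ext fun a => ?_
      exact IsFractionRing.lift_algebraMap hu a
    rw [e, aevalAeval_eq_eval₂]
  have := congrArg (eval₂ ψ v) hrs
  simp only [eval₂_add, eval₂_mul, key, h0, hf, mul_zero, add_zero, eval₂_one] at this
  exact zero_ne_one this

theorem aevalAeval_kernel (w : JumpLaw) (u v : F) (hu : u ≠ 0) (hv : v ≠ 0) :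
    aevalAeval u v w.kernel = u * v *
      ((∑ i ∈ Finset.Icc (-1 : ℤ) 1, algebraMap ℂ F (w.p i 1) * u ^ i) * v
      + ((∑ i ∈ Finset.Icc (-1 : ℤ) 1, algebraMap ℂ F (w.p i 0) * u ^ i) - 1)
      + (∑ i ∈ Finset.Icc (-1 : ℤ) 1, algebraMap ℂ F (w.p i (-1)) * u ^ i) / v) := by
  rw [kernel_eq]
  simp [icc_eq]
  field_simp
  ring

theorem injective_of_ker {K : ℂ[X][X]} (hd : K.natDegree ≠ 0) {u v : F}
    (h : ∀ f, aevalAeval u v f = 0 ↔ K ∣ f) : Function.Injective (aeval (R := ℂ) u) := by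
  rw [injective_iff_map_eq_zero]
  intro a ha
  by_contra hne
  have h1 : K ∣ C a := (h _).1 (by rw [aevalAeval_C, ha])
  have := natDegree_le_of_dvd h1 (by simpa using hne)
  rw [natDegree_C] at this
  omega

/-- If `(u, v)` is a generic point of the curve, then so is `(u, conjY u v)`, and the operation
is an involution. -/
theorem conjY_spec {w : JumpLaw} (hw : w.NonSingular) {u v : F}
    (h : ∀ f, aevalAeval u v f = 0 ↔ w.kernel ∣ f) :
    (∀ f, aevalAeval u (w.conjY u v) f = 0 ↔ w.kernel ∣ f) ∧ w.conjY u (w.conjY u v) = v := by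
  have hinj := injective_of_ker hw.natDegree_ne_zero h
  have hu : u ≠ 0 := by
    intro h0
    have : (X : ℂ[X]) = 0 := hinj (by simp [h0])
    exact X_ne_zero this
  have hv : v ≠ 0 := by
    intro h0
    have h1 : w.kernel ∣ X := (h _).1 (by rw [aevalAeval_Y, h0])
    have h2 := natDegree_le_of_dvd h1 X_ne_zero
    rw [natDegree_X] at h2
    have h3 := hw.natDegree_ne_zero
    exact hw (Or.inr (Or.inr (by omega)))
  have hA : (∑ i ∈ Finset.Icc (-1 : ℤ) 1, algebraMap ℂ F (w.p i 1) * u ^ i) ≠ 0 := by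
    intro h0
    refine hw.lead_ne_zero (hinj ?_)
    rw [map_zero, ← mul_zero u, ← h0]
    simp [icc_eq]
    field_simp
    ring
  have hC : (∑ i ∈ Finset.Icc (-1 : ℤ) 1, algebraMap ℂ F (w.p i (-1)) * u ^ i) ≠ 0 := by
    intro h0
    refine hw.const_ne_zero (hinj ?_)
    rw [map_zero, ← mul_zero u, ← h0]
    simp [icc_eq]
    field_simp
    ring
  have hv' : w.conjY u v ≠ 0 := by
    unfold conjY
    exact mul_ne_zero (one_div_ne_zero hv) (div_ne_zero hC hA)
  have hK : aevalAeval u v w.kernel = 0 := (h _).2 dvd_rfl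
  constructor
  · refine ker_eq_of_transcendental hw.irreducible hw.natDegree_ne_zero hinj ?_
    rw [aevalAeval_kernel _ _ _ hu hv] at hK
    rw [aevalAeval_kernel _ _ _ hu hv']
    have hK' := (mul_eq_zero.1 hK).resolve_left (mul_ne_zero hu hv)
    refine mul_eq_zero_of_right _ ?_
    rw [← hK']
    unfold conjY
    generalize (∑ i ∈ Finset.Icc (-1 : ℤ) 1, algebraMap ℂ F (w.p i 1) * u ^ i) = a at *
    generalize (∑ i ∈ Finset.Icc (-1 : ℤ) 1, algebraMap ℂ F (w.p i (-1)) * u ^ i) = c at *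
    field_simp
    ring
  · unfold conjY
    field_simp

/-- If `(u, v)` is a generic point of the curve, then so is `(conjX u v, v)`, and the operation
is an involution. -/
theorem conjX_spec {w : JumpLaw} (hw : w.NonSingular) {u v : F}
    (h : ∀ f, aevalAeval u v f = 0 ↔ w.kernel ∣ f) :
    (∀ f, aevalAeval (w.conjX u v) v f = 0 ↔ w.kernel ∣ f) ∧ w.conjX (w.conjX u v) v = u := by
  have hs : ∀ f g : ℂ[X][X], Bivariate.swap f ∣ g ↔ f ∣ Bivariate.swap g := by
    intro f g
    rw [← map_dvd_iff (Bivariate.swap (R := ℂ)), Bivariate.swap_swap_apply]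
  have h' : ∀ f, aevalAeval v u f = 0 ↔ w.transpose.kernel ∣ f := by
    intro f
    rw [kernel_transpose, hs, ← h, Bivariate.aevalAeval_swap]
  obtain ⟨h1, h2⟩ := conjY_spec hw.transpose h'
  refine ⟨fun f => ?_, h2⟩
  have h3 := h1 (Bivariate.swap f)
  rw [Bivariate.aevalAeval_swap, kernel_transpose, hs, Bivariate.swap_swap_apply] at h3
  exact h3

end Galois

section FunField

variable {w : JumpLaw} [hw : Fact w.NonSingular]

theorem aevalAeval_xy (f : ℂ[X][X]) :
    aevalAeval w.x w.y f = algebraMap w.CoordRing w.FunField (AdjoinRoot.mk w.kernel f) := by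
  have : aevalAeval w.x w.y = (IsScalarTower.toAlgHom ℂ w.CoordRing w.FunField).comp
      ((AdjoinRoot.mkₐ w.kernel).restrictScalars ℂ) := by
    refine Polynomial.algHom_ext' ?_ ?_
    · ext
      simp [x]
    · simp [y]
  rw [this]
  rfl

theorem ker_xy (f : ℂ[X][X]) : aevalAeval w.x w.y f = 0 ↔ w.kernel ∣ f := by
  rw [aevalAeval_xy, FaithfulSMul.algebraMap_eq_zero_iff]
  exact AdjoinRoot.mk_eq_zero

theorem algHom_ext {B : Type*} [CommRing B] [Algebra ℂ B]
    {f g : w.FunField →ₐ[ℂ] B} (hx : f w.x = g w.x) (hy : f w.y = g w.y) : f = g := by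
  refine IsLocalization.algHom_ext (nonZeroDivisors w.CoordRing) ?_
  refine AdjoinRoot.algHom_ext' ?_ hy
  ext
  exact hx

/-- The homomorphism from the coordinate ring that sends `(x, y)` to a generic point `(u, v)`. -/
def evalHom (u v : w.FunField)
    (h : ∀ f, aevalAeval u v f = 0 ↔ w.kernel ∣ f) : w.CoordRing →ₐ[ℂ] w.FunField :=
  AdjoinRoot.liftAlgHom w.kernel (aeval u) v
    (by rw [← aevalAeval_eq_eval₂]; exact (h _).2 dvd_rfl)

theorem evalHom_mk (u v : w.FunField) (h : ∀ f, aevalAeval u v f = 0 ↔ w.kernel ∣ f)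
    (f : ℂ[X][X]) : evalHom u v h (AdjoinRoot.mk w.kernel f) = aevalAeval u v f := by
  rw [aevalAeval_eq_eval₂]
  simp only [evalHom, AdjoinRoot.liftAlgHom_mk]

theorem evalHom_injective (u v : w.FunField) (h : ∀ f, aevalAeval u v f = 0 ↔ w.kernel ∣ f) :
    Function.Injective (evalHom u v h) := by
  rw [injective_iff_map_eq_zero]
  intro a ha
  obtain ⟨f, rfl⟩ := AdjoinRoot.mk_surjective (g := w.kernel) a
  rw [evalHom_mk] at ha
  exact (AdjoinRoot.mk_eq_zero (f := w.kernel)).2 ((h f).1 ha)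

/-- The endomorphism of the function field that sends `(x, y)` to a generic point `(u, v)`. -/
def specialize (u v : w.FunField)
    (h : ∀ f, aevalAeval u v f = 0 ↔ w.kernel ∣ f) : w.FunField →ₐ[ℂ] w.FunField :=
  IsFractionRing.liftAlgHom (evalHom_injective u v h)

theorem specialize_apply (u v : w.FunField)
    (h : ∀ f, aevalAeval u v f = 0 ↔ w.kernel ∣ f) (f : ℂ[X][X]) :
    specialize u v h (algebraMap w.CoordRing w.FunField (AdjoinRoot.mk w.kernel f)) =
      aevalAeval u v f := by
  rw [← evalHom_mk u v h]
  exact IsFractionRing.lift_algebraMap (A := w.CoordRing) (K := w.FunField)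
    (g := (evalHom u v h : w.CoordRing →+* w.FunField)) (evalHom_injective u v h) _

theorem specialize_x (u v : w.FunField)
    (h : ∀ f, aevalAeval u v f = 0 ↔ w.kernel ∣ f) : specialize u v h w.x = u := by
  rw [x, specialize_apply, aevalAeval_X]

theorem specialize_y (u v : w.FunField)
    (h : ∀ f, aevalAeval u v f = 0 ↔ w.kernel ∣ f) : specialize u v h w.y = v := by
  rw [y, specialize_apply, aevalAeval_Y]

theorem map_conjY {G : Type*} [Field G] [Algebra ℂ G] {F : Type*} [Field F] [Algebra ℂ F]
    (w : JumpLaw) (σ : F →ₐ[ℂ] G) (u v : F) : σ (w.conjY u v) = w.conjY (σ u) (σ v) := by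
  simp [conjY]

theorem map_conjX {G : Type*} [Field G] [Algebra ℂ G] {F : Type*} [Field F] [Algebra ℂ F]
    (w : JumpLaw) (σ : F →ₐ[ℂ] G) (u v : F) : σ (w.conjX u v) = w.conjX (σ u) (σ v) := by
  simp [conjX]

variable (w) in
/-- The automorphism `ξ` of the function field, as an endomorphism. -/
def xiHom : w.FunField →ₐ[ℂ] w.FunField :=
  specialize w.x (w.conjY w.x w.y) (conjY_spec hw.out ker_xy).1

variable (w) in
/-- The automorphism `η` of the function field, as an endomorphism. -/
def etaHom : w.FunField →ₐ[ℂ] w.FunField :=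
  specialize (w.conjX w.x w.y) w.y (conjX_spec hw.out ker_xy).1

theorem xiHom_comp : (xiHom w).comp (xiHom w) = AlgHom.id ℂ w.FunField := by
  refine algHom_ext ?_ ?_
  · simp [xiHom, specialize_x]
  · simp [xiHom, specialize_x, specialize_y, map_conjY, (conjY_spec hw.out ker_xy).2]

theorem etaHom_comp : (etaHom w).comp (etaHom w) = AlgHom.id ℂ w.FunField := by
  refine algHom_ext ?_ ?_
  · simp [etaHom, specialize_x, specialize_y, map_conjX, (conjX_spec hw.out ker_xy).2]
  · simp [etaHom, specialize_y]

variable (w) in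
/-- The automorphism `ξ` of the function field: it is the identity on `ℂ`, fixes `x` and sends
`y` to `(1 / y) (∑ p i (-1) x ^ i) / (∑ p i 1 x ^ i)`. -/
def xi : w.FunField ≃ₐ[ℂ] w.FunField :=
  AlgEquiv.ofAlgHom (xiHom w) (xiHom w) xiHom_comp xiHom_comp

variable (w) in
/-- The automorphism `η` of the function field: it is the identity on `ℂ`, fixes `y` and sends
`x` to `(1 / x) (∑ p (-1) j y ^ j) / (∑ p 1 j y ^ j)`. -/
def eta : w.FunField ≃ₐ[ℂ] w.FunField :=
  AlgEquiv.ofAlgHom (etaHom w) (etaHom w) etaHom_comp etaHom_comp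

theorem xi_x : xi w w.x = w.x :=
  specialize_x _ _ (conjY_spec hw.out ker_xy).1

theorem xi_y : xi w w.y = 1 / w.y *
    ((∑ i ∈ Finset.Icc (-1 : ℤ) 1, algebraMap ℂ w.FunField (w.p i (-1)) * w.x ^ i) /
      (∑ i ∈ Finset.Icc (-1 : ℤ) 1, algebraMap ℂ w.FunField (w.p i 1) * w.x ^ i)) :=
  specialize_y _ _ (conjY_spec hw.out ker_xy).1

theorem eta_x : eta w w.x = 1 / w.x *
    ((∑ j ∈ Finset.Icc (-1 : ℤ) 1, algebraMap ℂ w.FunField (w.p (-1) j) * w.y ^ j) /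
      (∑ j ∈ Finset.Icc (-1 : ℤ) 1, algebraMap ℂ w.FunField (w.p 1 j) * w.y ^ j)) :=
  specialize_x _ _ (conjX_spec hw.out ker_xy).1

theorem eta_y : eta w w.y = w.y :=
  specialize_y _ _ (conjX_spec hw.out ker_xy).1

variable (w) in
/-- The group of the walk: the group of automorphisms of the function field of the curve that is
generated by `ξ` and `η`. -/
def group : Subgroup (w.FunField ≃ₐ[ℂ] w.FunField) := Subgroup.closure {xi w, eta w}

end FunField

end JumpLaw

end

end QuarterPlane

/-! The kernel has bidegree (2, 2) on P¹ × P¹, and in every case considered the curve has a double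
point: at (1, 1) when the drift is zero, and at (0, ∞), (∞, 0), (∞, ∞) or (0, 0) in the four cases
of part (II). Let X and Y be coordinates on the two factors whose poles are at this point, for
instance X = 1/(x - 1) and Y = 1/(y - 1). In them the curve is a conic a Y² + b XY + c X² + d Y + e
X + g = 0. The map ξ fixes X and exchanges the two values of Y; η does the same with the roles
reversed.

If the asymptotic slopes s and t are distinct, the conic reads L M = const with L = Y - sX + c₁ and
M = Y - tX + c₂. Up to scalars both involutions swap L and M, so ξη multiplies L by s/t and M by
t/s. Hence ξη has the order of s/t in the ground field, and the group is dihedral of twice that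
order (`card_closure_conic_involutions`, `card_group_of_conic`).

It remains to find the slopes, the roots of a z² + b z + c. For zero drift, this form is given by
the second moments of the jumps, and the roots are √(c/a) exp(±iθ), so s/t = exp(2iθ). In part (II)
the roots are real, positive and distinct, so s/t is not a root of unity. A double root would make
the kernel a multiple of (x - y)² or (xy - 1)², against irreducibility. -/

/-! ### Dihedral groups and involutions of a conic -/

/-- The group generated by two involutions `a` and `b` has twice the order of `a * b`, unless it is
the cyclic group generated by `a * b`. -/
theorem Subgroup.card_closure_pair_of_involutions {G : Type*} [Group G] {a b : G}
    (ha : a * a = 1) (hb : b * b = 1) (hab : a ∉ Subgroup.zpowers (a * b)) :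
    Nat.card (Subgroup.closure {a, b}) = 2 * orderOf (a * b) := by
  have ha' : a⁻¹ = a := inv_eq_of_mul_eq_one_left ha
  have hb' : b⁻¹ = b := inv_eq_of_mul_eq_one_left hb
  set W := Subgroup.closure {a, b} with hW
  set H := Subgroup.zpowers (a * b) with hH
  have haW : a ∈ W := Subgroup.subset_closure (by simp)
  have hbW : b ∈ W := Subgroup.subset_closure (by simp)
  have hHW : H ≤ W := by
    rw [hH, Subgroup.zpowers_le]
    exact W.mul_mem haW hbW
  have hσ : a * b ∈ H := Subgroup.mem_zpowers _
  -- Conjugation by `a` inverts `a * b`, hence preserves `H`.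
  have hconj : ∀ h ∈ H, a * h * a ∈ H := by
    rintro _ ⟨k, rfl⟩
    have h1 : a * (a * b) ^ k * a = (a * (a * b) * a⁻¹) ^ k := by rw [conj_zpow, ha']
    have h2 : a * (a * b) * a⁻¹ = (a * b)⁻¹ := by
      rw [ha', mul_inv_rev, ha', hb', ← mul_assoc, ha, one_mul]
    change a * (a * b) ^ k * a ∈ H
    rw [h1, h2]
    exact H.zpow_mem (H.inv_mem hσ) k
  -- As `a` is an involution, `a * g ∈ H` means that `g` lies in the coset `aH`. The union of `H`
  -- and `aH` is stable under both generators, so it is all of `W`.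
  have hstep : ∀ s ∈ ({a, b} : Set G), ∀ g, g ∈ H ∨ a * g ∈ H → s * g ∈ H ∨ a * (s * g) ∈ H := by
    rintro s (rfl | rfl) g (ih | ih)
    · right; rwa [← mul_assoc, ha, one_mul]
    · exact Or.inl ih
    · right; rw [← mul_assoc]; exact H.mul_mem hσ ih
    · left
      have e : s * g = (a * s)⁻¹ * (a * g) := by
        rw [mul_inv_rev, ha', hb', mul_assoc, ← mul_assoc a a, ha, one_mul]
      rw [e]
      exact H.mul_mem (H.inv_mem hσ) ih
  have hor : ∀ g ∈ W, g ∈ H ∨ a * g ∈ H := by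
    intro g hg
    induction hg using Subgroup.closure_induction_left with
    | one => exact Or.inl H.one_mem
    | mul_left s hs g _ ih => exact hstep s hs g ih
    | inv_mul_cancel s hs g _ ih =>
      have hs' : s⁻¹ = s := by rcases hs with rfl | rfl <;> assumption
      rw [hs']
      exact hstep s hs g ih
  have hidx : (H.subgroupOf W).index = 2 := by
    rw [Subgroup.index_eq_two_iff]
    refine ⟨⟨a, haW⟩, fun g => ?_⟩
    simp only [Subgroup.mem_subgroupOf, Subgroup.coe_mul]
    by_cases hg : (g : G) ∈ H
    · refine Or.inr ⟨hg, fun h => hab ?_⟩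
      simpa using H.mul_mem (H.inv_mem hg) h
    · refine Or.inl ⟨?_, hg⟩
      have h1 := hconj _ ((hor g g.2).resolve_left hg)
      rwa [← mul_assoc, ha, one_mul] at h1
  -- `Nat.card` and `orderOf` are both 0 in the infinite case, so no finiteness is needed.
  have h1 := (H.subgroupOf W).card_mul_index
  rw [hidx, Nat.card_congr (Subgroup.subgroupOfEquivOfLe hHW).toEquiv, hH, Nat.card_zpowers] at h1
  omega

/-- Two involutions of a field that exchange the points of a conic with the same abscissa, and with
the same ordinate respectively, generate a dihedral group. The conic is given by its asymptotic
slopes `s` and `t`. -/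
theorem card_closure_conic_involutions {k F : Type*} [Field k] [Field F] [Algebra k F]
    {ξ η : F ≃ₐ[k] F} (hξ : ξ * ξ = 1) (hη : η * η = 1) {X Y : F}
    (hξX : ξ X = X) (hηY : η Y = Y) (hξY : ξ Y ≠ Y) (hηX : η X ≠ X)
    (hext : ∀ φ : F ≃ₐ[k] F, φ X = X → φ Y = Y → φ = 1)
    (hind : ∀ a b c : k, algebraMap k F a * X + algebraMap k F b * Y + algebraMap k F c = 0 →
      a = 0 ∧ b = 0)
    {s t d e g : k} (hs : s ≠ 0) (ht : t ≠ 0) (hst : s ≠ t)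
    (hconic : Y ^ 2 - (algebraMap k F s + algebraMap k F t) * X * Y
      + algebraMap k F s * algebraMap k F t * X ^ 2 + algebraMap k F d * Y + algebraMap k F e * X
      + algebraMap k F g = 0) :
    Nat.card (Subgroup.closure {ξ, η}) = 2 * orderOf (s / t) := by
  set ι := algebraMap k F with hι
  have hs' : ι s ≠ 0 := by simpa [hι] using hs
  have ht' : ι t ≠ 0 := by simpa [hι] using ht
  have hts : t - s ≠ 0 := sub_ne_zero.2 hst.symm
  have hts' : ι t - ι s ≠ 0 := by
    rw [← map_sub]
    exact (_root_.map_ne_zero ι).2 hts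
  -- Vieta: `ξ Y` is the other root of the conic viewed as a quadratic in `Y`. Likewise for `η X`
  -- below.
  have eξ : ξ Y = -Y + (ι s + ι t) * X - ι d := by
    have h := congrArg ξ hconic
    simp only [map_add, map_sub, map_mul, map_pow, hξX, hι, AlgEquiv.commutes, map_zero] at h
    rw [← hι] at h
    have h2 : (ξ Y - Y) * (ξ Y + Y - (ι s + ι t) * X + ι d) = 0 := by
      linear_combination h - hconic
    linear_combination (mul_eq_zero.1 h2).resolve_left (sub_ne_zero.2 hξY)
  have eη : ι s * ι t * η X = -(ι s * ι t * X) + (ι s + ι t) * Y - ι e := by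
    have h := congrArg η hconic
    simp only [map_add, map_sub, map_mul, map_pow, hηY, hι, AlgEquiv.commutes, map_zero] at h
    rw [← hι] at h
    have h2 : (η X - X) * (ι s * ι t * (η X + X) - (ι s + ι t) * Y + ι e) = 0 := by
      linear_combination h - hconic
    linear_combination (mul_eq_zero.1 h2).resolve_left (sub_ne_zero.2 hηX)
  have comm : ∀ (φ : F ≃ₐ[k] F) (c : k), φ (ι c) = ι c := fun φ c => φ.commutes c
  -- The constants place `L = 0` and `M = 0` on the asymptotes: the linear terms of `L * M` match
  -- those of the conic when `c₁ + c₂ = d` and `t c₁ + s c₂ = -e`.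
  obtain ⟨c₁, hc₁⟩ : ∃ c : k, c * (t - s) = -(e + s * d) :=
    ⟨-(e + s * d) / (t - s), div_mul_cancel₀ _ hts⟩
  have hc₁' : ι c₁ * (ι t - ι s) = -(ι e + ι s * ι d) := by
    simpa only [map_mul, map_sub, map_neg, map_add] using congrArg ι hc₁
  set c₂ := d - c₁ with hc₂
  have hc₂' : ι c₂ = ι d - ι c₁ := map_sub _ _ _
  set L := Y - ι s * X + ι c₁ with hL
  set M := Y - ι t * X + ι c₂ with hM
  have ξL : ξ L = -M := by
    rw [hL, hM, map_add, map_sub, map_mul, comm, comm, hξX, eξ, hc₂']; ring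
  have ηL : ι t * η L = -(ι s * M) := by
    rw [hL, hM, map_add, map_sub, map_mul, comm, comm, hηY, hc₂']
    linear_combination hc₁' - eη
  have ηM : ι s * η M = -(ι t * L) := by
    rw [hL, hM, map_add, map_sub, map_mul, comm, comm, hηY, hc₂']
    linear_combination hc₁' - eη
  have ξM : ξ M = -L := by
    rw [hL, hM, map_add, map_sub, map_mul, comm, comm, hξX, eξ, hc₂']; ring
  have hq : ι (s / t) = ι s / ι t := map_div₀ _ _ _
  have hq' : ι (t / s) = ι t / ι s := map_div₀ _ _ _
  have σL : (ξ * η) L = ι (s / t) * L := by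
    have h := congrArg ξ ηL
    rw [map_mul, map_neg, map_mul, comm, comm, ξM] at h
    rw [hq, AlgEquiv.mul_apply]
    field_simp
    linear_combination h
  have σM : (ξ * η) M = ι (t / s) * M := by
    have h := congrArg ξ ηM
    rw [map_mul, map_neg, map_mul, comm, comm, ξL] at h
    rw [hq', AlgEquiv.mul_apply]
    field_simp
    linear_combination h
  have pow_eigen : ∀ (φ : F ≃ₐ[k] F) (c : k) (Z : F), φ Z = ι c * Z →
      ∀ n : ℕ, (φ ^ n) Z = ι (c ^ n) * Z := by
    intro φ c Z h n
    induction n with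
    | zero => simp
    | succ n ih =>
      rw [pow_succ', AlgEquiv.mul_apply, ih, map_mul, comm, h, ← mul_assoc, ← map_mul, ← pow_succ]
  have hL0 : L ≠ 0 := by
    intro h
    have := hind (-s) 1 c₁ (by rw [map_neg, map_one, ← h, hL]; ring)
    exact one_ne_zero this.2
  have hqn : ∀ n : ℕ, (ξ * η) ^ n = 1 ↔ (s / t) ^ n = 1 := by
    intro n
    have h1 := pow_eigen _ _ _ σL n
    have h2 := pow_eigen _ _ _ σM n
    constructor
    · intro h
      rw [h, AlgEquiv.one_apply] at h1
      have h3 : ι ((s / t) ^ n) = 1 := mul_right_cancel₀ hL0 (by rw [← h1, one_mul])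
      exact (algebraMap k F).injective (by rw [← hι, h3, map_one])
    · intro h
      have h' : (t / s) ^ n = 1 := by rw [← inv_div, inv_pow, h, inv_one]
      rw [h, map_one, one_mul] at h1
      rw [h', map_one, one_mul] at h2
      -- An automorphism fixing `L` and `M` fixes `X`, since `L - M` is `(t - s) X` plus a constant,
      -- and then `Y`.
      have hX : ((ξ * η) ^ n) X = X := by
        have e1 : (ι t - ι s) * X = L - M + (ι c₂ - ι c₁) := by rw [hL, hM]; ring
        have e2 := congrArg ((ξ * η) ^ n) e1
        rw [map_mul, map_add, map_sub, map_sub, map_sub, comm, comm, comm, comm, h1, h2, ← e1] at e2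
        exact mul_left_cancel₀ hts' e2
      refine hext _ hX ?_
      have e1 : Y = L + ι s * X - ι c₁ := by rw [hL]; ring
      conv_lhs => rw [e1]
      rw [map_sub, map_add, map_mul, comm, comm, h1, hX, ← e1]
  have hord : orderOf (ξ * η) = orderOf (s / t) := by
    refine Nat.dvd_antisymm ?_ ?_
    · rw [orderOf_dvd_iff_pow_eq_one, hqn, pow_orderOf_eq_one]
    · rw [orderOf_dvd_iff_pow_eq_one, ← hqn, pow_orderOf_eq_one]
  rw [Subgroup.card_closure_pair_of_involutions hξ hη, hord]
  -- Powers of `ξ * η` scale `L`, whereas `ξ L = -M` is not a multiple of `L`; so `ξ` is not among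
  -- these powers.
  have not_eigen : ∀ c : k, ξ L ≠ ι c * L := by
    intro c h
    rw [ξL] at h
    have h1 : ι (t + c * s) * X + ι (-(1 + c)) * Y + ι (-(c₂ + c * c₁)) = 0 := by
      simp only [map_add, map_neg, map_mul, map_one]
      rw [hL, hM] at h
      linear_combination h
    obtain ⟨h2, h3⟩ := hind _ _ _ h1
    refine hts ?_
    linear_combination h2 + s * h3
  rintro ⟨n, hn⟩
  change (ξ * η) ^ n = ξ at hn
  obtain ⟨m, rfl | rfl⟩ := n.eq_nat_or_neg
  · rw [zpow_natCast] at hn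
    exact not_eigen _ (by rw [← hn]; exact pow_eigen _ _ _ σL m)
  · rw [zpow_neg, zpow_natCast] at hn
    have hn' : (ξ * η) ^ m = ξ := by
      rw [← inv_inv ((ξ * η) ^ m), hn]
      exact inv_eq_of_mul_eq_one_left hξ
    exact not_eigen _ (by rw [← hn']; exact pow_eigen _ _ _ σL m)

/-! ### Generic points of the curve and polar coordinates at a node -/

namespace QuarterPlane.JumpLaw

theorem NonSingular.two_le_natDegree {w : JumpLaw} (hw : w.NonSingular) :
    2 ≤ w.kernel.natDegree := by
  have h0 := hw.natDegree_ne_zero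
  have h1 : w.kernel.natDegree ≠ 1 := fun h => hw (Or.inr (Or.inr h))
  omega

section Generic

variable {F : Type*} [Field F] [Algebra ℂ F] {w : JumpLaw} {u v : F}

theorem ker_transpose (h : ∀ f, aevalAeval u v f = 0 ↔ w.kernel ∣ f) (f : ℂ[X][X]) :
    aevalAeval v u f = 0 ↔ w.transpose.kernel ∣ f := by
  rw [kernel_transpose, ← map_dvd_iff (Bivariate.swap (R := ℂ)), Bivariate.swap_swap_apply, ← h,
    Bivariate.aevalAeval_swap]

/-- No nonzero polynomial of degree at most `1` in `y` vanishes at a generic point. -/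
theorem eq_zero_of_linear (hw : w.NonSingular) (h : ∀ f, aevalAeval u v f = 0 ↔ w.kernel ∣ f)
    {a b : ℂ[X]} (hab : aeval u a * v + aeval u b = 0) : a = 0 ∧ b = 0 := by
  have h1 : w.kernel ∣ C a * X + C b := by
    rw [← h]
    simpa using hab
  have h2 : C a * X + C b = 0 := by
    refine eq_zero_of_dvd_of_natDegree_lt h1 ?_
    have := hw.two_le_natDegree
    have := natDegree_linear_le (a := a) (b := b)
    omega
  exact ⟨by simpa using congrArg (coeff · 1) h2, by simpa using congrArg (coeff · 0) h2⟩

theorem eq_zero_of_bilinear (hw : w.NonSingular) (h : ∀ f, aevalAeval u v f = 0 ↔ w.kernel ∣ f)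
    {a b c d : ℂ} (habcd : algebraMap ℂ F a * u * v + algebraMap ℂ F b * u + algebraMap ℂ F c * v
      + algebraMap ℂ F d = 0) : a = 0 ∧ b = 0 ∧ c = 0 ∧ d = 0 := by
  obtain ⟨h1, h2⟩ := eq_zero_of_linear hw h (a := C a * X + C c) (b := C b * X + C d) (by
    simp only [map_add, map_mul, aeval_C, aeval_X]
    linear_combination habcd)
  have e : ∀ {p q : ℂ}, C p * X + C q = 0 → p = 0 ∧ q = 0 := fun {p q} h =>
    ⟨by simpa using congrArg (coeff · 1) h, by simpa using congrArg (coeff · 0) h⟩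
  exact ⟨(e h1).1, (e h2).1, (e h1).2, (e h2).2⟩

theorem x_sub_ne_zero (hw : w.NonSingular) (h : ∀ f, aevalAeval u v f = 0 ↔ w.kernel ∣ f)
    (c : ℂ) : u - algebraMap ℂ F c ≠ 0 := fun h0 => by
  have := eq_zero_of_bilinear hw h (a := 0) (b := 1) (c := 0) (d := -c)
    (by simp only [map_zero, map_one, map_neg]; linear_combination h0)
  exact one_ne_zero this.2.1

theorem y_sub_ne_zero (hw : w.NonSingular) (h : ∀ f, aevalAeval u v f = 0 ↔ w.kernel ∣ f)
    (c : ℂ) : v - algebraMap ℂ F c ≠ 0 := fun h0 => by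
  have := eq_zero_of_bilinear hw h (a := 0) (b := 0) (c := 1) (d := -c)
    (by simp only [map_zero, map_one, map_neg]; linear_combination h0)
  exact one_ne_zero this.2.2.1

/-- The kernel is separable in `y`. -/
theorem conjY_ne (hw : w.NonSingular) (h : ∀ f, aevalAeval u v f = 0 ↔ w.kernel ∣ f) :
    w.conjY u v ≠ v := by
  intro hv
  have hu0 : u ≠ 0 := by simpa using x_sub_ne_zero hw h 0
  have hv0 : v ≠ 0 := by simpa using y_sub_ne_zero hw h 0
  have hK := (h _).2 dvd_rfl
  rw [aevalAeval_kernel _ _ _ hu0 hv0] at hK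
  have hK' := (mul_eq_zero.1 hK).resolve_left (mul_ne_zero hu0 hv0)
  -- Division by zero gives 0, so a vanishing denominator would force `conjY u v = 0`.
  have hA : (∑ i ∈ Finset.Icc (-1 : ℤ) 1, algebraMap ℂ F (w.p i 1) * u ^ i) ≠ 0 := by
    intro h0
    rw [conjY, h0, div_zero, mul_zero] at hv
    exact hv0 hv.symm
  have hC : (∑ i ∈ Finset.Icc (-1 : ℤ) 1, algebraMap ℂ F (w.p i (-1)) * u ^ i) / v =
      (∑ i ∈ Finset.Icc (-1 : ℤ) 1, algebraMap ℂ F (w.p i 1) * u ^ i) * v := by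
    rw [conjY, div_mul_div_comm, one_mul, div_eq_iff (mul_ne_zero hv0 hA)] at hv
    rw [hv]
    field_simp
  rw [hC] at hK'
  refine hw.lead_ne_zero ?_
  -- At a double root the y-derivative of the kernel vanishes too. It is linear in `v`, so its
  -- leading coefficient, twice that of the kernel, would be 0.
  have h1 := eq_zero_of_linear hw h
    (a := C 2 * (C (w.p 1 1 : ℂ) * X ^ 2 + C (w.p 0 1 : ℂ) * X + C (w.p (-1) 1 : ℂ)))
    (b := C (w.p 1 0 : ℂ) * X ^ 2 + C ((w.p 0 0 : ℂ) - 1) * X + C (w.p (-1) 0 : ℂ)) (by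
      rw [← mul_zero u, ← hK']
      simp [icc_eq, map_ofNat]
      field_simp
      ring)
  exact (mul_eq_zero.1 h1.1).resolve_left (by simp)

theorem conjX_ne (hw : w.NonSingular) (h : ∀ f, aevalAeval u v f = 0 ↔ w.kernel ∣ f) :
    w.conjX u v ≠ u :=
  conjY_ne hw.transpose (ker_transpose h)

end Generic

/-- The possible nodes of the curve have coordinates in the projective line. The local coordinate
whose pole is at the point: `z` at infinity and `1 / (z - c)` at `c`. -/
noncomputable def polarCoord {F : Type*} [Field F] [Algebra ℂ F] (c : WithTop ℂ) (z : F) : F :=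
  match c with
  | ⊤ => z
  | (c : ℂ) => (z - algebraMap ℂ F c)⁻¹

section FunField

variable {w : JumpLaw} [hw : Fact w.NonSingular]

theorem map_polarCoord {F : Type*} [Field F] [Algebra ℂ F] (σ : F ≃ₐ[ℂ] F) (c : WithTop ℂ) (z : F) :
    σ (polarCoord c z) = polarCoord c (σ z) := by
  cases c <;> simp [polarCoord]

theorem polarCoord_injective {F : Type*} [Field F] [Algebra ℂ F] (c : WithTop ℂ) :
    Function.Injective (polarCoord c : F → F) := by
  intro z z' h
  cases c with
  | top => exact h
  | coe c => simpa [polarCoord] using h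

/-- Clearing the poles turns an affine relation between the two coordinates into one of bidegree at
most (1, 1) in x and y, which is trivial because the kernel has degree 2 in y. -/
theorem polarCoord_indep (c c' : WithTop ℂ) {α β γ : ℂ}
    (h : algebraMap ℂ w.FunField α * polarCoord c w.x + algebraMap ℂ w.FunField β *
      polarCoord c' w.y + algebraMap ℂ w.FunField γ = 0) : α = 0 ∧ β = 0 := by
  have hx := x_sub_ne_zero hw.out (ker_xy (w := w))
  have hy := y_sub_ne_zero hw.out (ker_xy (w := w))
  have key := @eq_zero_of_bilinear _ _ _ _ _ _ hw.out (ker_xy (w := w))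
  cases c with
  | top =>
    cases c' with
    | top =>
      have := key (a := 0) (b := α) (c := β) (d := γ) (by
        simp only [polarCoord] at h
        rw [map_zero]
        linear_combination h)
      tauto
    | coe c' =>
      simp only [polarCoord] at h
      have hy := hy c'
      field_simp at h
      have := key (a := α) (b := -(α * c')) (c := γ) (d := β - γ * c') (by
        simp only [map_sub, map_mul, map_neg]
        linear_combination h)
      obtain ⟨rfl, -, rfl, h3⟩ := this
      simpa using h3
  | coe c =>
    have hx := hx c
    cases c' with
    | top =>
      simp only [polarCoord] at h
      field_simp at h
      have := key (a := β) (b := γ) (c := -(β * c)) (d := α - γ * c) (by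
        simp only [map_sub, map_mul, map_neg]
        linear_combination h)
      obtain ⟨rfl, rfl, -, h3⟩ := this
      simpa using h3
    | coe c' =>
      have hy := hy c'
      simp only [polarCoord] at h
      field_simp at h
      have := key (a := γ) (b := β - γ * c') (c := α - γ * c)
        (d := γ * c * c' - α * c' - β * c) (by
        simp only [map_sub, map_mul]
        linear_combination h)
      obtain ⟨rfl, h2, h3, -⟩ := this
      exact ⟨by simpa using h3, by simpa using h2⟩

/-- If the curve becomes a conic in the polar coordinates at a node, then the order of the group is
determined by the slopes of the branches at the node. -/
theorem card_group_of_conic (P Q : WithTop ℂ) {a b c d e g s t : ℂ} (ha : a ≠ 0)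
    (hs : s ≠ 0) (ht : t ≠ 0) (hst : s ≠ t) (hb : a * (s + t) = -b) (hc : a * (s * t) = c)
    (hconic : ∀ X Y : w.FunField, X = polarCoord P w.x → Y = polarCoord Q w.y →
      algebraMap ℂ w.FunField a * Y ^ 2 + algebraMap ℂ w.FunField b * (X * Y)
      + algebraMap ℂ w.FunField c * X ^ 2 + algebraMap ℂ w.FunField d * Y
      + algebraMap ℂ w.FunField e * X + algebraMap ℂ w.FunField g = 0) :
    Nat.card w.group = 2 * orderOf (s / t) := by
  have hconic' := hconic _ _ rfl rfl
  have ha' : algebraMap ℂ w.FunField a ≠ 0 := (_root_.map_ne_zero _).2 ha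
  obtain rfl : b = -(a * (s + t)) := by rw [hb, neg_neg]
  subst hc
  -- The linear and constant coefficients are rescaled so that the conic can be divided by `a`.
  obtain ⟨d, rfl⟩ : ∃ d', d = a * d' := ⟨d / a, by field_simp⟩
  obtain ⟨e, rfl⟩ : ∃ e', e = a * e' := ⟨e / a, by field_simp⟩
  obtain ⟨g, rfl⟩ : ∃ g', g = a * g' := ⟨g / a, by field_simp⟩
  simp only [map_mul, map_add, map_neg] at hconic'
  refine card_closure_conic_involutions (X := polarCoord P w.x) (Y := polarCoord Q w.y)
    ?_ ?_ ?_ ?_ ?_ ?_ ?_ (fun _ _ _ => polarCoord_indep P Q) hs ht hst (d := d) (e := e) (g := g)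
    (mul_left_cancel₀ ha' (by linear_combination hconic'))
  · exact AlgEquiv.ext fun z => DFunLike.congr_fun (xiHom_comp (w := w)) z
  · exact AlgEquiv.ext fun z => DFunLike.congr_fun (etaHom_comp (w := w)) z
  · rw [map_polarCoord, xi_x]
  · rw [map_polarCoord, eta_y]
  · rw [map_polarCoord, xi_y]
    exact (polarCoord_injective Q).ne (conjY_ne hw.out ker_xy)
  · rw [map_polarCoord, eta_x]
    exact (polarCoord_injective P).ne (conjX_ne hw.out ker_xy)
  · intro φ h1 h2
    rw [map_polarCoord] at h1 h2
    have h3 : (φ : w.FunField →ₐ[ℂ] w.FunField) = AlgHom.id ℂ _ :=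
      algHom_ext (polarCoord_injective P h1) (polarCoord_injective Q h2)
    exact AlgEquiv.ext fun z => DFunLike.congr_fun h3 z

theorem finite_group_iff {n : ℕ} (h : Nat.card w.group = 2 * n) :
    Finite w.group ↔ n ≠ 0 := by
  constructor
  · intro _ h0
    exact Nat.card_pos.ne' (h.trans (by rw [h0]))
  · intro h0
    exact Nat.finite_of_card_ne_zero (by omega)

end FunField

end QuarterPlane.JumpLaw

/-! ### Roots of unity and degenerate kernels -/

namespace QuarterPlane.JumpLaw

theorem exp_two_mul_I_pow_eq_one_iff (θ : ℝ) (n : ℕ) :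
    Complex.exp (2 * θ * Complex.I) ^ n = 1 ↔ ∃ k : ℤ, (n : ℝ) * (θ / Real.pi) = k := by
  rw [← Complex.exp_nat_mul, Complex.exp_eq_one_iff]
  refine exists_congr fun k => ?_
  have hπ : (Real.pi : ℂ) ≠ 0 := by exact_mod_cast Real.pi_ne_zero
  have h2 : (n : ℂ) * (2 * θ * Complex.I) = k * (2 * Real.pi * Complex.I) ↔
      (n : ℂ) * (θ / Real.pi) = k := by
    rw [← mul_div_assoc, div_eq_iff hπ]
    constructor
    · intro h
      have h3 : (2 * Complex.I) * ((n : ℂ) * θ) = (2 * Complex.I) * (k * Real.pi) := by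
        linear_combination h
      exact mul_left_cancel₀ (mul_ne_zero two_ne_zero Complex.I_ne_zero) h3
    · intro h
      linear_combination 2 * Complex.I * h
  rw [h2]
  exact_mod_cast Iff.rfl

/-- A factor of degree 1 in y is not a unit, so its square cannot divide an irreducible kernel. This
excludes the double curves (x - y)² and (xy - 1)², where the two slopes coincide. -/
theorem NonSingular.kernel_ne_mul_sq {w : JumpLaw} (hw : w.NonSingular) (r : ℂ[X][X])
    {a b : ℂ[X]} (ha : a ≠ 0) : w.kernel ≠ r * (C a * X + C b) ^ 2 := by
  intro h
  have hf : ¬ IsUnit (C a * X + C b) := fun hu => by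
    have := natDegree_eq_zero_of_isUnit hu
    rw [natDegree_linear ha] at this
    exact one_ne_zero this
  rw [pow_two, ← mul_assoc] at h
  rcases hw.irreducible.isUnit_or_isUnit h with h1 | h1
  · exact hf (isUnit_of_mul_isUnit_right h1)
  · exact hf h1

theorem NonSingular.up_ne_zero {w : JumpLaw} (hw : w.NonSingular) :
    ¬ (w.p 1 1 = 0 ∧ w.p 0 1 = 0 ∧ w.p (-1) 1 = 0) := by
  rintro ⟨h1, h2, h3⟩
  exact hw.lead_ne_zero (by simp [h1, h2, h3])

theorem NonSingular.down_ne_zero {w : JumpLaw} (hw : w.NonSingular) :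
    ¬ (w.p 1 (-1) = 0 ∧ w.p 0 (-1) = 0 ∧ w.p (-1) (-1) = 0) := by
  rintro ⟨h1, h2, h3⟩
  exact hw.const_ne_zero (by simp [h1, h2, h3])

theorem NonSingular.right_ne_zero {w : JumpLaw} (hw : w.NonSingular) :
    ¬ (w.p 1 1 = 0 ∧ w.p 1 0 = 0 ∧ w.p 1 (-1) = 0) :=
  hw.transpose.up_ne_zero

theorem NonSingular.left_ne_zero {w : JumpLaw} (hw : w.NonSingular) :
    ¬ (w.p (-1) 1 = 0 ∧ w.p (-1) 0 = 0 ∧ w.p (-1) (-1) = 0) :=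
  hw.transpose.down_ne_zero

theorem nonneg_all (w : JumpLaw) :
    0 ≤ w.p (-1) (-1) ∧ 0 ≤ w.p (-1) 0 ∧ 0 ≤ w.p (-1) 1 ∧ 0 ≤ w.p 0 (-1) ∧ 0 ≤ w.p 0 0 ∧
      0 ≤ w.p 0 1 ∧ 0 ≤ w.p 1 (-1) ∧ 0 ≤ w.p 1 0 ∧ 0 ≤ w.p 1 1 := by
  refine ⟨?_, ?_, ?_, ?_, ?_, ?_, ?_, ?_, ?_⟩ <;> exact w.nonneg _ (by decide) _ (by decide)

theorem sum_all (w : JumpLaw) :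
    w.p 1 1 + w.p 0 1 + w.p (-1) 1 + w.p 1 0 + w.p 0 0 + w.p (-1) 0 + w.p 1 (-1) + w.p 0 (-1)
      + w.p (-1) (-1) = 1 := by
  have h := w.sum_eq_one
  simp [icc_eq] at h
  linarith

/-- The equality case of the Cauchy-Schwarz inequality for two variables with values in
`{-1, 0, 1}`: they are proportional. Here `α`, `β` are the masses of `{ij = 1}` and `{ij = -1}`, and
`γ`, `δ` those of `{i ≠ 0, j = 0}` and `{i = 0, j ≠ 0}`. -/
theorem eq_zero_of_mul_le_sq {α β γ δ : ℝ} (hα : 0 ≤ α) (hβ : 0 ≤ β) (hγ : 0 ≤ γ) (hδ : 0 ≤ δ)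
    (h1 : 0 < α + β + γ) (h2 : 0 < α + β + δ)
    (h : (α + β + γ) * (α + β + δ) ≤ (α - β) ^ 2) : γ = 0 ∧ δ = 0 ∧ α * β = 0 := by
  have m1 := mul_nonneg (add_nonneg hα hβ) hγ
  have m2 := mul_nonneg (add_nonneg hα hβ) hδ
  have m3 := mul_nonneg hγ hδ
  have m4 := mul_nonneg hα hβ
  -- The difference of the two sides of `h` is a sum of nonnegative terms, so each of them vanishes.
  have h' : (α + β) * γ + (α + β) * δ + γ * δ + 4 * (α * β) ≤ 0 := by linear_combination h
  have z1 : (α + β) * γ = 0 := by linarith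
  have z2 : (α + β) * δ = 0 := by linarith
  have z3 : γ * δ = 0 := by linarith
  refine ⟨?_, ?_, by linarith⟩
  · by_contra hγ1
    have := (mul_eq_zero.1 z1).resolve_right hγ1
    have := (mul_eq_zero.1 z3).resolve_left hγ1
    linarith
  · by_contra hδ1
    have := (mul_eq_zero.1 z2).resolve_right hδ1
    have := (mul_eq_zero.1 z3).resolve_right hδ1
    linarith

/-! ### The slopes at the node -/

section FunField

variable {w : JumpLaw} [hw : Fact w.NonSingular]

theorem kernel_xy : algebraMap ℂ w.FunField (w.p 1 1) * (w.x ^ 2 * w.y ^ 2)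
    + algebraMap ℂ w.FunField (w.p 0 1) * (w.x * w.y ^ 2)
    + algebraMap ℂ w.FunField (w.p (-1) 1) * w.y ^ 2
    + algebraMap ℂ w.FunField (w.p 1 0) * (w.x ^ 2 * w.y)
    + (algebraMap ℂ w.FunField (w.p 0 0) - 1) * (w.x * w.y)
    + algebraMap ℂ w.FunField (w.p (-1) 0) * w.y
    + algebraMap ℂ w.FunField (w.p 1 (-1)) * w.x ^ 2
    + algebraMap ℂ w.FunField (w.p 0 (-1)) * w.x
    + algebraMap ℂ w.FunField (w.p (-1) (-1)) = 0 := by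
  rw [← (ker_xy (w := w) _).2 dvd_rfl, kernel_eq]
  simp
  ring

/-- If the branches at the node are real and distinct, with slopes of the same sign, then the group
is infinite. -/
theorem infinite_group_of_real_branches (P Q : WithTop ℂ) {a c d e g : ℝ} (ha : 0 < a) (hc : 0 < c)
    (hac : a + c ≤ 1 - w.p 0 0) (hne : ¬ (a = c ∧ a + c = 1 - w.p 0 0))
    (hconic : ∀ X Y : w.FunField, X = polarCoord P w.x → Y = polarCoord Q w.y →
      algebraMap ℂ w.FunField a * Y ^ 2 + (algebraMap ℂ w.FunField (w.p 0 0) - 1) * (X * Y)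
      + algebraMap ℂ w.FunField c * X ^ 2 + algebraMap ℂ w.FunField d * Y
      + algebraMap ℂ w.FunField e * X + algebraMap ℂ w.FunField g = 0) :
    Infinite w.group := by
  obtain ⟨b, hb⟩ : ∃ b, b = 1 - w.p 0 0 := ⟨_, rfl⟩
  rw [← hb] at hac hne
  -- b² ≥ (a + c)² ≥ 4ac, and `hne` forbids equality in both places.
  have hdisc : 0 < b ^ 2 - 4 * a * c := by
    rcases hac.lt_or_eq with h | h
    · nlinarith [sq_nonneg (a - c)]
    · have : a - c ≠ 0 := fun h' => hne ⟨by linarith, h⟩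
      have := sq_pos_of_ne_zero this
      rw [← h]
      nlinarith
  obtain ⟨r, hr, hr2⟩ : ∃ r : ℝ, 0 < r ∧ r ^ 2 = b ^ 2 - 4 * a * c :=
    ⟨_, Real.sqrt_pos.2 hdisc, Real.sq_sqrt hdisc.le⟩
  -- This makes the smaller slope `t` positive, so that `s / t` is a real number greater than 1.
  have hrb : r < b := by
    refine lt_of_pow_lt_pow_left₀ 2 (by linarith) ?_
    rw [hr2]
    nlinarith [mul_pos ha hc]
  obtain ⟨s, hs⟩ : ∃ s, s = (b + r) / (2 * a) := ⟨_, rfl⟩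
  obtain ⟨t, ht⟩ : ∃ t, t = (b - r) / (2 * a) := ⟨_, rfl⟩
  have hs0 : 0 < s := by rw [hs]; exact div_pos (by linarith) (by linarith)
  have ht0 : 0 < t := by rw [ht]; exact div_pos (by linarith) (by linarith)
  have hts : t < s := by rw [hs, ht]; gcongr; linarith
  have hsum : a * (s + t) = b := by rw [hs, ht]; field_simp; ring
  have hprod : a * (s * t) = c := by
    rw [hs, ht]
    field_simp
    linear_combination -hr2
  have hcard : Nat.card w.group = 2 * orderOf ((s : ℂ) / t) :=
    card_group_of_conic P Q (a := a) (b := (w.p 0 0 : ℂ) - 1) (c := c) (d := d) (e := e) (g := g)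
      (by exact_mod_cast ha.ne') (by exact_mod_cast hs0.ne') (by exact_mod_cast ht0.ne')
      (by exact_mod_cast hts.ne')
      (by
        rw [hb] at hsum
        have : a * (s + t) = -(w.p 0 0 - 1) := by rw [hsum]; ring
        exact_mod_cast this)
      (by exact_mod_cast hprod)
      (fun X Y hX hY => by rw [map_sub, map_one]; exact hconic X Y hX hY)
  rw [← not_finite_iff_infinite, finite_group_iff hcard, not_not]
  rw [orderOf_eq_zero_iff, isOfFinOrder_iff_pow_eq_one]
  rintro ⟨n, hn, h⟩
  have h' : (s / t) ^ n = 1 := by exact_mod_cast h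
  exact (one_lt_pow₀ ((one_lt_div ht0).2 hts) hn.ne').ne' h'

/-- Without a corner of the Newton square and its two neighbours, the curve has a double point at
(0, ∞), (∞, 0), (∞, ∞) or (0, 0) respectively. The slopes depend only on `p 0 0 - 1` and on the two
corners adjacent to the missing one, which are positive by non-singularity. -/
theorem infinite_group_of_corner
    (h : (w.p 0 1 = 0 ∧ w.p (-1) 0 = 0 ∧ w.p (-1) 1 = 0) ∨
        (w.p 1 0 = 0 ∧ w.p 1 (-1) = 0 ∧ w.p 0 (-1) = 0) ∨
        (w.p 1 0 = 0 ∧ w.p 0 1 = 0 ∧ w.p 1 1 = 0) ∨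
        (w.p 0 (-1) = 0 ∧ w.p (-1) 0 = 0 ∧ w.p (-1) (-1) = 0)) :
    Infinite w.group := by
  have hsum := w.sum_all
  obtain ⟨n1, n2, n3, n4, n5, n6, n7, n8, n9⟩ := w.nonneg_all
  have hx : w.x ≠ 0 := by simpa using x_sub_ne_zero hw.out (ker_xy (w := w)) 0
  have hy : w.y ≠ 0 := by simpa using y_sub_ne_zero hw.out (ker_xy (w := w)) 0
  have hK := kernel_xy (w := w)
  have up := hw.out.up_ne_zero
  have down := hw.out.down_ne_zero
  have left := hw.out.left_ne_zero
  have right := hw.out.right_ne_zero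
  have hsq := fun r => hw.out.kernel_ne_mul_sq r (a := 1) (b := -X) one_ne_zero
  have hsq' := fun r => hw.out.kernel_ne_mul_sq r (a := X) (b := -1) X_ne_zero
  have pos : ∀ {a : ℝ}, 0 ≤ a → a ≠ 0 → 0 < a := fun h h' => lt_of_le_of_ne h h'.symm
  rcases h with ⟨h1, h2, h3⟩ | ⟨h1, h2, h3⟩ | ⟨h1, h2, h3⟩ | ⟨h1, h2, h3⟩ <;>
    simp only [h1, h2, h3, Complex.ofReal_zero, map_zero, zero_mul, add_zero] at hK
  · refine infinite_group_of_real_branches ((0 : ℂ) : WithTop ℂ) ⊤ (a := w.p 1 1)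
      (c := w.p (-1) (-1)) (d := w.p 1 0) (e := w.p 0 (-1)) (g := w.p 1 (-1))
      (pos n9 (by tauto)) (pos n1 (by tauto)) (by linarith) (fun ⟨h4, h5⟩ => ?_) ?_
    -- Equality leaves no mass for the other jumps, and the kernel becomes a multiple of (xy - 1)².
    · refine hsq' (C (C (w.p 1 1 : ℂ))) ?_
      have e1 : w.p 1 0 = 0 := by linarith
      have e2 : w.p 1 (-1) = 0 := by linarith
      have e3 : w.p 0 (-1) = 0 := by linarith
      have e4 : w.p 0 0 = 1 - w.p 1 1 - w.p 1 1 := by linarith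
      simp [kernel_eq, h1, h2, h3, e1, e2, e3, ← h4, e4]
      ring
    · rintro _ _ rfl rfl
      simp only [polarCoord, map_zero, sub_zero]
      field_simp
      linear_combination hK
  · refine infinite_group_of_real_branches ⊤ ((0 : ℂ) : WithTop ℂ) (a := w.p (-1) (-1))
      (c := w.p 1 1) (d := w.p (-1) 0) (e := w.p 0 1) (g := w.p (-1) 1)
      (pos n1 (by tauto)) (pos n9 (by tauto)) (by linarith) (fun ⟨h4, h5⟩ => ?_) ?_
    · refine hsq' (C (C (w.p 1 1 : ℂ))) ?_
      have e1 : w.p (-1) 0 = 0 := by linarith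
      have e2 : w.p (-1) 1 = 0 := by linarith
      have e3 : w.p 0 1 = 0 := by linarith
      have e4 : w.p 0 0 = 1 - w.p 1 1 - w.p 1 1 := by linarith
      simp [kernel_eq, h1, h2, h3, e1, e2, e3, h4, e4]
      ring
    · rintro _ _ rfl rfl
      simp only [polarCoord, map_zero, sub_zero]
      field_simp
      linear_combination hK
  · refine infinite_group_of_real_branches ⊤ ⊤ (a := w.p (-1) 1)
      (c := w.p 1 (-1)) (d := w.p (-1) 0) (e := w.p 0 (-1)) (g := w.p (-1) (-1))
      (pos n3 (by tauto)) (pos n7 (by tauto)) (by linarith) (fun ⟨h4, h5⟩ => ?_) ?_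
    · refine hsq (C (C (w.p (-1) 1 : ℂ))) ?_
      have e1 : w.p (-1) 0 = 0 := by linarith
      have e2 : w.p (-1) (-1) = 0 := by linarith
      have e3 : w.p 0 (-1) = 0 := by linarith
      have e4 : w.p 0 0 = 1 - w.p (-1) 1 - w.p (-1) 1 := by linarith
      simp [kernel_eq, h1, h2, h3, e1, e2, e3, ← h4, e4]
      ring
    · rintro _ _ rfl rfl
      simp only [polarCoord]
      linear_combination hK
  · refine infinite_group_of_real_branches ((0 : ℂ) : WithTop ℂ) ((0 : ℂ) : WithTop ℂ)
      (a := w.p 1 (-1)) (c := w.p (-1) 1) (d := w.p 1 0) (e := w.p 0 1) (g := w.p 1 1)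
      (pos n7 (by tauto)) (pos n3 (by tauto)) (by linarith) (fun ⟨h4, h5⟩ => ?_) ?_
    · refine hsq (C (C (w.p (-1) 1 : ℂ))) ?_
      have e1 : w.p 1 0 = 0 := by linarith
      have e2 : w.p 1 1 = 0 := by linarith
      have e3 : w.p 0 1 = 0 := by linarith
      have e4 : w.p 0 0 = 1 - w.p (-1) 1 - w.p (-1) 1 := by linarith
      simp [kernel_eq, h1, h2, h3, e1, e2, e3, h4, e4]
      ring
    · rintro _ _ rfl rfl
      simp only [polarCoord, map_zero, sub_zero]
      field_simp
      linear_combination hK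

/-- Total mass 1 and zero drift make the kernel and its first derivatives vanish at (1, 1). Its
quadratic part a u² + b uv + c v² there is given by the second moments: 2a = ∑ i² p, b = ∑ ij p, 2c
= ∑ j² p. -/
theorem card_group_of_drift_eq_zero (h : w.drift = 0) :
    Nat.card w.group = 2 * orderOf (Complex.exp (2 * w.theta * Complex.I)) := by
  have hsum := w.sum_all
  obtain ⟨n1, n2, n3, n4, n5, n6, n7, n8, n9⟩ := w.nonneg_all
  have hK := kernel_xy (w := w)
  obtain ⟨dx, dy⟩ := Prod.ext_iff.1 h
  simp [drift, icc_eq] at dx dy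
  obtain ⟨a, ha⟩ : ∃ a, a = w.p 1 1 + w.p 1 0 + w.p 1 (-1) := ⟨_, rfl⟩
  obtain ⟨b, hb⟩ : ∃ b, b = w.p 1 1 + w.p (-1) (-1) - w.p 1 (-1) - w.p (-1) 1 := ⟨_, rfl⟩
  obtain ⟨c, hc⟩ : ∃ c, c = w.p 1 1 + w.p 0 1 + w.p (-1) 1 := ⟨_, rfl⟩
  have ha0 : 0 < a := by
    refine lt_of_le_of_ne (by linarith) fun h0 => hw.out.right_ne_zero ?_
    refine ⟨?_, ?_, ?_⟩ <;> linarith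
  have hc0 : 0 < c := by
    refine lt_of_le_of_ne (by linarith) fun h0 => hw.out.up_ne_zero ?_
    refine ⟨?_, ?_, ?_⟩ <;> linarith
  -- Strict Cauchy-Schwarz, that is |R| < 1. Equality confines the nonzero jumps to one diagonal;
  -- zero drift makes the two of them equally likely, and the kernel is a multiple of a square.
  have hdisc : b ^ 2 < (2 * a) * (2 * c) := by
    by_contra hlt
    obtain ⟨hγz, hδz, z4⟩ := eq_zero_of_mul_le_sq (α := w.p 1 1 + w.p (-1) (-1))
      (β := w.p 1 (-1) + w.p (-1) 1) (γ := w.p 1 0 + w.p (-1) 0) (δ := w.p 0 1 + w.p 0 (-1))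
      (by linarith) (by linarith) (by linarith) (by linarith) (by linarith) (by linarith) (by
        have e1 : w.p 1 1 + w.p (-1) (-1) + (w.p 1 (-1) + w.p (-1) 1) + (w.p 1 0 + w.p (-1) 0)
          = 2 * a := by linarith
        have e2 : w.p 1 1 + w.p (-1) (-1) + (w.p 1 (-1) + w.p (-1) 1) + (w.p 0 1 + w.p 0 (-1))
          = 2 * c := by linarith
        have e3 : w.p 1 1 + w.p (-1) (-1) - (w.p 1 (-1) + w.p (-1) 1) = b := by linarith
        rw [e1, e2, e3]
        exact not_lt.1 hlt)
    have p10 : w.p 1 0 = 0 := by linarith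
    have p10' : w.p (-1) 0 = 0 := by linarith
    have p01 : w.p 0 1 = 0 := by linarith
    have p01' : w.p 0 (-1) = 0 := by linarith
    rcases mul_eq_zero.1 z4 with h0 | h0
    · have p11 : w.p 1 1 = 0 := by linarith
      have p11' : w.p (-1) (-1) = 0 := by linarith
      have p1 : w.p 1 (-1) = w.p (-1) 1 := by linarith
      have p00 : w.p 0 0 = 1 - w.p (-1) 1 - w.p (-1) 1 := by linarith
      refine hw.out.kernel_ne_mul_sq (C (C (w.p (-1) 1 : ℂ))) (a := 1) (b := -X) one_ne_zero ?_
      simp [kernel_eq, p10, p10', p01, p01', p11, p11', p1, p00]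
      ring
    · have p11 : w.p 1 (-1) = 0 := by linarith
      have p11' : w.p (-1) 1 = 0 := by linarith
      have p1 : w.p (-1) (-1) = w.p 1 1 := by linarith
      have p00 : w.p 0 0 = 1 - w.p 1 1 - w.p 1 1 := by linarith
      refine hw.out.kernel_ne_mul_sq (C (C (w.p 1 1 : ℂ))) (a := X) (b := -1) X_ne_zero ?_
      simp [kernel_eq, p10, p10', p01, p01', p11, p11', p1, p00]
      ring
  obtain ⟨m, hm0, hm⟩ : ∃ m : ℝ, 0 < m ∧ m = √(2 * a) := ⟨_, Real.sqrt_pos.2 (by linarith), rfl⟩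
  obtain ⟨n, hn0, hn⟩ : ∃ n : ℝ, 0 < n ∧ n = √(2 * c) := ⟨_, Real.sqrt_pos.2 (by linarith), rfl⟩
  have hm2 : m ^ 2 = 2 * a := by rw [hm, Real.sq_sqrt (by linarith)]
  have hn2 : n ^ 2 = 2 * c := by rw [hn, Real.sq_sqrt (by linarith)]
  have hcorr : w.corr = b / (m * n) := by
    rw [corr, hm, hn]
    congr 3
    · simp [icc_eq]; linarith
    · simp [icc_eq]; linarith
    · simp [icc_eq]; linarith
  have habs : |w.corr| < 1 := by
    rw [hcorr, abs_div, abs_of_pos (mul_pos hm0 hn0), div_lt_one (mul_pos hm0 hn0)]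
    refine abs_lt_of_sq_lt_sq ?_ (mul_pos hm0 hn0).le
    rw [mul_pow, hm2, hn2]
    exact hdisc
  obtain ⟨hR1, hR2⟩ := abs_lt.1 habs
  have hcos : Real.cos w.theta = -w.corr := Real.cos_arccos (by linarith) (by linarith)
  have hθ0 : 0 < w.theta := Real.arccos_pos.2 (by linarith)
  have hθπ : w.theta < Real.pi := by
    refine lt_of_le_of_ne (Real.arccos_le_pi _) fun h0 => ?_
    rw [h0, Real.cos_pi] at hcos
    linarith
  -- The slopes are (n/m) exp(±iθ): their product is c/a, and their sum is -b/a because cos θ =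
  -- -b/(mn).
  have hq : Complex.exp (2 * w.theta * Complex.I) =
      (n / m * Complex.exp (w.theta * Complex.I)) /
        (n / m * Complex.exp (-(w.theta * Complex.I))) := by
    have : ((n : ℂ) / m) ≠ 0 := by exact_mod_cast (div_pos hn0 hm0).ne'
    rw [mul_div_mul_left _ _ this, ← Complex.exp_sub]
    congr 1
    ring
  have hm' : (m : ℂ) ≠ 0 := by exact_mod_cast hm0.ne'
  have hn' : (n : ℂ) ≠ 0 := by exact_mod_cast hn0.ne'
  have hnm : (n : ℂ) / m ≠ 0 := div_ne_zero hn' hm'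
  rw [hq]
  refine card_group_of_conic ((1 : ℂ) : WithTop ℂ) ((1 : ℂ) : WithTop ℂ) (a := a) (b := b) (c := c)
    (d := 2 * w.p 1 1 + w.p 1 0) (e := 2 * w.p 1 1 + w.p 0 1) (g := w.p 1 1)
    (by exact_mod_cast ha0.ne') (mul_ne_zero hnm (Complex.exp_ne_zero _))
    (mul_ne_zero hnm (Complex.exp_ne_zero _)) (fun hst => ?_) ?_ ?_ ?_
  -- Equal slopes would make θ/π an integer, but 0 < θ < π.
  · rw [hst, div_self (mul_ne_zero hnm (Complex.exp_ne_zero _))] at hq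
    obtain ⟨k, hk⟩ := (exp_two_mul_I_pow_eq_one_iff w.theta 1).1 (by rw [hq, pow_one])
    rw [Nat.cast_one, one_mul] at hk
    have h1 : (0 : ℝ) < k := by rw [← hk]; exact div_pos hθ0 Real.pi_pos
    have h2 : (k : ℝ) < 1 := by rw [← hk]; exact (div_lt_one Real.pi_pos).2 hθπ
    have h3 : 0 < k := by exact_mod_cast h1
    have h4 : k < 1 := by exact_mod_cast h2
    omega
  · have h1 : a * (n / m * (2 * Real.cos w.theta)) = -b := by
      rw [hcos, hcorr]
      field_simp
      linear_combination b * hm2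
    have h2 : (2 : ℂ) * Complex.cos w.theta =
        Complex.exp (w.theta * Complex.I) + Complex.exp (-(w.theta * Complex.I)) := by
      rw [Complex.two_cos, neg_mul]
    rw [← mul_add, ← h2]
    exact_mod_cast h1
  · have h1 : a * (n / m * (n / m)) = c := by
      field_simp
      linear_combination a * hn2 - c * hm2
    have h2 : Complex.exp (w.theta * Complex.I) * Complex.exp (-(w.theta * Complex.I)) = 1 := by
      rw [← Complex.exp_add, add_neg_cancel, Complex.exp_zero]
    have h1' : (a : ℂ) * (n / m * (n / m)) = c := by exact_mod_cast h1
    rw [← h1']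
    linear_combination (a * (n / m * (n / m)) : ℂ) * h2
  · rintro _ _ rfl rfl
    have hx := x_sub_ne_zero hw.out (ker_xy (w := w)) 1
    have hy := y_sub_ne_zero hw.out (ker_xy (w := w)) 1
    simp only [polarCoord]
    rw [map_one] at hx hy ⊢
    obtain ⟨u, hu⟩ : ∃ u, w.x = u + 1 := ⟨w.x - 1, by ring⟩
    obtain ⟨v, hv⟩ : ∃ v, w.y = v + 1 := ⟨w.y - 1, by ring⟩
    rw [hu, hv] at hK
    rw [hu, add_sub_cancel_right] at hx ⊢
    rw [hv, add_sub_cancel_right] at hy ⊢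
    have toF : ∀ {r : ℝ}, r = 0 → algebraMap ℂ w.FunField (r : ℂ) = 0 := by
      rintro _ rfl; simp
    have hsum' := toF (sub_eq_zero.2 hsum)
    have dx' := toF dx
    have dy' := toF dy
    rw [ha, hb, hc]
    push_cast at hsum' dx' dy' ⊢
    simp only [map_ofNat] at hsum' dx' dy' ⊢
    field_simp
    -- In K(1 + u, 1 + v) the total mass minus 1 enters the coefficients of 1, u, v and uv, the
    -- horizontal drift those of u and uv, and the vertical drift those of v and uv.
    linear_combination hK - hsum' * (1 + u + v + u * v) - dx' * (u + u * v) - dy' * (v + u * v)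

end FunField

end QuarterPlane.JumpLaw

/-! ### Orders as infima, rationality of θ/π, and the conclusion -/

theorem orderOf_eq_sInf {G : Type*} [Monoid G] {g : G} (h : IsOfFinOrder g) :
    orderOf g = sInf {l : ℕ | 1 ≤ l ∧ g ^ l = 1} := by
  have hmem : orderOf g ∈ {l : ℕ | 1 ≤ l ∧ g ^ l = 1} := ⟨h.orderOf_pos, pow_orderOf_eq_one g⟩
  have h1 := Nat.sInf_mem ⟨_, hmem⟩
  exact le_antisymm (orderOf_le_of_pow_eq_one h1.1 h1.2) (Nat.sInf_le hmem)

theorem exists_nat_mul_eq_int_iff (r : ℝ) :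
    (∃ n : ℕ, 0 < n ∧ ∃ k : ℤ, (n : ℝ) * r = k) ↔ ∃ q : ℚ, r = q := by
  constructor
  · rintro ⟨n, hn, k, h⟩
    refine ⟨k / n, ?_⟩
    have : (n : ℝ) ≠ 0 := by exact_mod_cast hn.ne'
    push_cast
    rw [eq_div_iff this, mul_comm, h]
  · rintro ⟨q, rfl⟩
    refine ⟨q.den, q.den_pos, q.num, ?_⟩
    have := Rat.den_mul_eq_num q
    exact_mod_cast this

theorem theorem1 (w : QuarterPlane.JumpLaw) [Fact w.NonSingular] :
    (w.drift = 0 →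
      (Finite w.group ↔ ∃ q : ℚ, w.theta / Real.pi = (q : ℝ)) ∧
      (Finite w.group →
        Nat.card w.group =
          2 * sInf {l : ℕ | 1 ≤ l ∧ ∃ k : ℤ, (l : ℝ) * (w.theta / Real.pi) = (k : ℝ)})) ∧
    (w.drift ≠ 0 →
      ((w.p 0 1 = 0 ∧ w.p (-1) 0 = 0 ∧ w.p (-1) 1 = 0) ∨
        (w.p 1 0 = 0 ∧ w.p 1 (-1) = 0 ∧ w.p 0 (-1) = 0) ∨
        (w.p 1 0 = 0 ∧ w.p 0 1 = 0 ∧ w.p 1 1 = 0) ∨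
        (w.p 0 (-1) = 0 ∧ w.p (-1) 0 = 0 ∧ w.p (-1) (-1) = 0)) →
      Infinite w.group) := by
  refine ⟨fun h => ?_, fun _ h => QuarterPlane.JumpLaw.infinite_group_of_corner h⟩
  have hcard := QuarterPlane.JumpLaw.card_group_of_drift_eq_zero h
  have hfin : Finite w.group ↔ IsOfFinOrder (Complex.exp (2 * w.theta * Complex.I)) := by
    rw [QuarterPlane.JumpLaw.finite_group_iff hcard, Ne, orderOf_eq_zero_iff, not_not]
  constructor
  · rw [hfin, isOfFinOrder_iff_pow_eq_one, ← exists_nat_mul_eq_int_iff]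
    simp only [QuarterPlane.JumpLaw.exp_two_mul_I_pow_eq_one_iff]
  · intro hf
    rw [hcard, orderOf_eq_sInf (hfin.1 hf)]
    simp only [QuarterPlane.JumpLaw.exp_two_mul_I_pow_eq_one_iff]
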